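/- A countable Borel equivalence relation is a pair $(X,E)$, where $X$ is a (possibly empty) standard Borel space and $E$ is an equivalence relation on $X$ that is Borel as a subset of $X^2$ and has only countable classes. Let $\mathcal E$ be the class of all of these. Let $(X,E),(Y,F)\in\mathcal E$. A class-bijective Borel homomorphism from $E$ to $F$ is a Borel map $f:X\to Y$ such that $x\mathrel E y$ implies $f(x)\mathrel F f(y)$ and such that, for every $x\in X$, $f$ restricts to a bijection $[x]_E\to[f(x)]_F$; we write $E\to_B^{cb}F$ if one exists. We write $E\sqsubseteq_B^i F$ if there is an invariant Borel embedding of $E$ into $F$, i.e. a class-bijective Borel homomorphism $f$ from $E$ to $F$ such that moreover $f(x)\mathrel F f(y)$ implies $x\mathrel E y$. A theory is a pair $(L,\sigma)$, where $L$ is a countable relational language whose relation symbols have arity at least $1$ and $\sigma$ is an $L_{\omega_1\omega}$-sentence. A Borel $\sigma$-structure on $(X,E)$ is an $L$-structure $\mathbb A=(X,R^{\mathbb A})_{R\in L}$ such that, for each $n$-ary $R\in L$, the set $R^{\mathbb A}\subseteq X^n$ is Borel and $R^{\mathbb A}(x_1,\dots,x_n)$ implies $x_1\mathrel E x_2\mathrel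 E\cdots\mathrel E x_n$, and such that for every $E$-class $C$ the restriction $\mathbb A|C$ satisfies $\sigma$. Let $\mathcal E_\sigma$ be the class of all $E\in\mathcal E$ on which there is a Borel $\sigma$-structure. A class $\mathcal C\subseteq\mathcal E$ is called elementary if $\mathcal C=\mathcal E_\sigma$ for some theory $(L,\sigma)$. An element $E\in\mathcal C$ is called invariantly universal in $\mathcal C$ if $F\sqsubseteq_B^i E$ for every $F\in\mathcal C$. **Corollary 4.9.** A class $\mathcal C\subseteq\mathcal E$ of countable Borel equivalence relations is elementary if and only if it is downward closed under class-bijective Borel homomorphisms (that is, $E\to_B^{cb}F$ and $F\in\mathcal C$ imply $E\in\mathcal C$) and contains an element that is invariantly universal in $\mathcal C$. In that case, for every $E\in\mathcal C$ that is invariantly universal in $\mathcal C$, $$\mathcal C=\mathcal E_E:=\{F\in\mathcal E : F\to_B^{cb}E\}.$$ -/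

import Mathlib

/-!
Countable Borel equivalence relations, the homomorphisms between them, countable relational
theories in the infinitary logic with countable conjunctions, and structurability.
-/

universe u v

namespace Structurability

/-! ### Theories in the infinitary logic -/

/-- Formulas of the infinitary logic `L_{ω₁ω}` over a relational language `L`, with free variables
indexed by `Fin n`. As `L` has no function symbols, terms are variables. Negation, disjunction
(finite or countable), finite conjunction and the existential quantifier are the usual
abbreviations: `¬φ` is `φ → ⊥`, `⋁ φᵢ` is `¬⋀ ¬φᵢ`, and `∃x φ` is `¬∀x ¬φ`. -/
inductive InfFormula (L : FirstOrder.Language.{0, 0}) : ℕ → Type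
  | falsum {n : ℕ} : InfFormula L n
  | equal {n : ℕ} (i j : Fin n) : InfFormula L n
  | rel {n k : ℕ} (R : L.Relations k) (t : Fin k → Fin n) : InfFormula L n
  | imp {n : ℕ} (φ ψ : InfFormula L n) : InfFormula L n
  | conj {n : ℕ} (φ : ℕ → InfFormula L n) : InfFormula L n
  | all {n : ℕ} (φ : InfFormula L (n + 1)) : InfFormula L n

/-- Tarski's definition of truth of a formula in a structure, under an assignment `x` of the free
variables; the quantifier binds the last variable. -/
def InfFormula.Realize {L : FirstOrder.Language.{0, 0}} {M : Type v} (S : L.Structure M) :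
    {n : ℕ} → InfFormula L n → (Fin n → M) → Prop
  | _, .falsum, _ => False
  | _, .equal i j, x => x i = x j
  | _, .rel R t, x => S.RelMap R (fun k => x (t k))
  | _, .imp φ ψ, x => φ.Realize S x → ψ.Realize S x
  | _, .conj φ, x => ∀ i : ℕ, (φ i).Realize S x
  | _, .all φ, x => ∀ a : M, φ.Realize S (Fin.snoc x a)

/-- A theory: a countable relational language, all of whose relation symbols have arity at least
one, together with a single `L_{ω₁ω}`-sentence in it. -/
structure InfTheory where
  lang : FirstOrder.Language.{0, 0}
  relational : lang.IsRelational
  countable_rel : Countable (Σ n, lang.Relations n)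
  arity_pos : IsEmpty (lang.Relations 0)
  sentence : InfFormula lang 0

/-- `M`, with the structure `S`, is a model of the theory. -/
def InfTheory.Models (T : InfTheory) {M : Type v} (S : T.lang.Structure M) : Prop :=
  T.sentence.Realize S Fin.elim0

/-- The restriction `S|A` of a structure in a relational language to a subset of its universe. -/
abbrev restrict {L : FirstOrder.Language.{0, 0}} (hL : L.IsRelational) {M : Type v}
    (S : L.Structure M) (A : Set M) : L.Structure A where
  funMap {n} f _ := ((hL n).false f).elim
  RelMap R x := S.RelMap R (fun k => (x k : M))

/-! ### Countable Borel equivalence relations -/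

/-- A countable Borel equivalence relation: an equivalence relation on a (possibly empty) standard
Borel space, Borel as a subset of the square, all of whose classes are countable. -/
structure CBER where
  carrier : Type u
  [measurableSpace : MeasurableSpace carrier]
  [standardBorel : StandardBorelSpace carrier]
  rel : carrier → carrier → Prop
  equivalence : Equivalence rel
  measurableSet_rel : MeasurableSet {p : carrier × carrier | rel p.1 p.2}
  countable_class : ∀ x, {y | rel x y}.Countable

attribute [instance] CBER.measurableSpace CBER.standardBorel

namespace CBER

/-- The equivalence class of `x`. -/
def cls (E : CBER.{u}) (x : E.carrier) : Set E.carrier := {y | E.rel x y}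

/-- `f` is a Borel homomorphism from `E` to `F`. -/
def IsHom (E F : CBER.{u}) (f : E.carrier → F.carrier) : Prop :=
  Measurable f ∧ ∀ x y, E.rel x y → F.rel (f x) (f y)

/-- `f` is a class-bijective Borel homomorphism from `E` to `F`: it restricts to a bijection from
the class of `x` onto the class of `f x`, for every `x`. -/
def IsClassBijective (E F : CBER.{u}) (f : E.carrier → F.carrier) : Prop :=
  IsHom E F f ∧ ∀ x, Set.BijOn f (E.cls x) (F.cls (f x))

/-- `f` is a Borel reduction from `E` to `F`. -/
def IsReduction (E F : CBER.{u}) (f : E.carrier → F.carrier) : Prop :=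
  IsHom E F f ∧ ∀ x y, F.rel (f x) (f y) → E.rel x y

/-- `E →_B^{cb} F`: some class-bijective Borel homomorphism from `E` to `F` exists. -/
def ClassBijects (E F : CBER.{u}) : Prop :=
  ∃ f : E.carrier → F.carrier, IsClassBijective E F f

/-- `E ⊑_B^i F`: there is an invariant Borel embedding of `E` into `F`, i.e. a class-bijective
Borel reduction (equivalently, an injective Borel reduction with `F`-invariant image). -/
def InvEmbeds (E F : CBER.{u}) : Prop :=
  ∃ f : E.carrier → F.carrier, IsClassBijective E F f ∧ IsReduction E F f

/-- `S` is a Borel structure on the equivalence relation `E`: every relation is a Borel set, and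
relates only elements of one and the same `E`-class. -/
def IsBorelStructureOn (E : CBER.{u}) {L : FirstOrder.Language.{0, 0}}
    (S : L.Structure E.carrier) : Prop :=
  ∀ (n : ℕ) (R : L.Relations n),
    MeasurableSet {x : Fin n → E.carrier | S.RelMap R x} ∧
    ∀ x : Fin n → E.carrier, S.RelMap R x → ∀ i j, E.rel (x i) (x j)

/-- `E ⊨ σ`: there is a Borel structure on `E` whose restriction to each `E`-class is a model. -/
def Structurable (E : CBER.{u}) (T : InfTheory) : Prop :=
  ∃ S : T.lang.Structure E.carrier, E.IsBorelStructureOn S ∧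
    ∀ x, T.Models (restrict T.relational S (E.cls x))

/-- `𝓔_E`, the class of all `F` with `F →_B^{cb} E`. -/
def elementaryClass (E : CBER.{u}) : Set CBER.{u} := {F | ClassBijects F E}

end CBER

/-- The class `𝓒` is elementary: it is the class `𝓔_σ` of all `σ`-structurable countable Borel
equivalence relations, for some theory `σ`. -/
def IsElementary (𝓒 : Set CBER.{u}) : Prop :=
  ∃ T : InfTheory, 𝓒 = {E | E.Structurable T}

/-- `𝓒` is downward closed under class-bijective Borel homomorphisms. -/
def IsClosedUnderClassBijective (𝓒 : Set CBER.{u}) : Prop :=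
  ∀ E F : CBER.{u}, E.ClassBijects F → F ∈ 𝓒 → E ∈ 𝓒

/-- `E` is an invariantly universal element of `𝓒`. -/
def IsInvariantlyUniversalIn (E : CBER.{u}) (𝓒 : Set CBER.{u}) : Prop :=
  E ∈ 𝓒 ∧ ∀ F ∈ 𝓒, F.InvEmbeds E

end Structurability

/-! Everything rests on the Lusin–Novikov theorem (`sigmaInjOn_univ_of_measurable`): the classes of
a countable Borel equivalence relation are enumerated by Borel functions `g n`, and the relation is
a countable union of Borel graphs.

If `𝓒` is the class of `σ`-structurable relations, structures pull back along class-bijective maps,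
so `𝓒` is downward closed. For universality, let words in the `g n` act on a structured `E`, and
label each point by a real that identifies it and by the truth values of all relations at tuples of
words. Recording the labels along all words embeds `E` invariantly into a shift. The `g n` need not
be invertible, hence a free monoid and the restriction to the part of the shift where its orbits
form an equivalence relation. The labels define a Borel structure there, and the points whose class
is a model of `σ` form an invariant Borel set (`measurableSet_models`), on which the shift is
invariantly universal.

Conversely, closure and an invariantly universal `E` force `𝓒 = 𝓔_E`. This class is elementary
(`isElementary_elementaryClass`): a class-bijective map to `E` amounts to marking each point with a
real coding its image, reals are coded by countably many unary predicates, and Borel conditions on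
finitely many such reals are expressible in `L_{ω₁ω}`. -/

namespace Structurability

/-! ### Countable-to-one Borel maps (Lusin–Novikov) -/

section LusinNovikov

open Set Topology TopologicalSpace MeasureTheory Filter

/-- `A` is covered by countably many Borel sets on each of which `f` is injective. -/
def SigmaInjOn {Z X : Type*} [MeasurableSpace Z] (f : Z → X) (A : Set Z) : Prop :=
  ∃ B : ℕ → Set Z, (∀ n, MeasurableSet (B n) ∧ InjOn f (B n)) ∧ A ⊆ ⋃ n, B n

theorem SigmaInjOn.mono {Z X : Type*} [MeasurableSpace Z] {f : Z → X} {A A' : Set Z}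
    (h : SigmaInjOn f A') (hA : A ⊆ A') : SigmaInjOn f A := by
  obtain ⟨B, hB, hc⟩ := h
  exact ⟨B, hB, hA.trans hc⟩

theorem SigmaInjOn.of_injOn {Z X : Type*} [MeasurableSpace Z] {f : Z → X} {A : Set Z}
    (hA : MeasurableSet A) (h : InjOn f A) : SigmaInjOn f A :=
  ⟨fun _ => A, fun _ => ⟨hA, h⟩, subset_iUnion (fun _ : ℕ => A) 0⟩

theorem SigmaInjOn.iUnion {Z X ι : Type*} [MeasurableSpace Z] [Countable ι] {f : Z → X}
    {A : ι → Set Z} (h : ∀ i, SigmaInjOn f (A i)) : SigmaInjOn f (⋃ i, A i) := by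
  choose B hB hc using h
  rcases isEmpty_or_nonempty ι with hι | hι
  · exact ⟨fun _ => ∅, by simp, by simp⟩
  obtain ⟨e, he⟩ := exists_surjective_nat (ι × ℕ)
  refine ⟨fun n => B (e n).1 (e n).2, fun n => hB _ _, iUnion_subset fun i z hz => ?_⟩
  obtain ⟨n, hn⟩ := mem_iUnion.1 (hc i hz)
  obtain ⟨m, hm⟩ := he (i, n)
  exact mem_iUnion.2 ⟨m, by simpa [hm] using hn⟩

theorem SigmaInjOn.union {Z X : Type*} [MeasurableSpace Z] {f : Z → X} {A A' : Set Z}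
    (h : SigmaInjOn f A) (h' : SigmaInjOn f A') : SigmaInjOn f (A ∪ A') := by
  rw [union_eq_iUnion]
  exact SigmaInjOn.iUnion fun b => by cases b <;> assumption

/-- The open sets `U i`, for `i ∈ s`, do not have a common part of their images that can be
covered by Borel sets over each of which one of the `U i` is small. -/
def IsLargeFamily {Z X : Type*} [MeasurableSpace Z] [MeasurableSpace X]
    (f : Z → X) (s : Finset ℕ) (U : ℕ → Set Z) : Prop :=
  ¬ ∃ S : ℕ → Set X, (∀ i ∈ s, MeasurableSet (S i) ∧ SigmaInjOn f (U i ∩ f ⁻¹' S i)) ∧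
    (⋂ i ∈ s, f '' U i) ⊆ ⋃ i ∈ s, S i

theorem IsLargeFamily.nonempty {Z X : Type*} [MeasurableSpace Z] [MeasurableSpace X]
    {f : Z → X} {s : Finset ℕ} {U : ℕ → Set Z} (h : IsLargeFamily f s U) :
    (⋂ i ∈ s, f '' U i).Nonempty := by
  by_contra hne
  rw [not_nonempty_iff_eq_empty] at hne
  refine h ⟨fun _ => ∅, fun i _ => ⟨MeasurableSet.empty, ?_⟩, by simp [hne]⟩
  exact (SigmaInjOn.of_injOn MeasurableSet.empty (injOn_empty f)).mono (by simp)

theorem exists_countableBasis_small {Z : Type*} [MetricSpace Z] [SecondCountableTopology Z]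
    {U : Set Z} (hU : IsOpen U) {ε : ℝ} (hε : 0 < ε) {z z' : Z}
    (hz : z ∈ U) (hz' : z' ∈ U) (hne : z ≠ z') :
    ∃ V ∈ countableBasis Z, ∃ W ∈ countableBasis Z, z ∈ V ∧ z' ∈ W ∧ closure V ⊆ U ∧
      closure W ⊆ U ∧ Disjoint V W ∧ (∀ x ∈ V, ∀ y ∈ V, dist x y ≤ ε) ∧
      ∀ x ∈ W, ∀ y ∈ W, dist x y ≤ ε := by
  have key : ∀ x ∈ U, ∃ V ∈ countableBasis Z, x ∈ V ∧ closure V ⊆ U ∧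
      (∀ y ∈ V, dist y x < dist z z' / 2) ∧ ∀ y ∈ V, ∀ y' ∈ V, dist y y' ≤ ε := by
    intro x hx
    obtain ⟨r, hr, hrU⟩ := Metric.nhds_basis_closedBall.mem_iff.1 (hU.mem_nhds hx)
    have hd : 0 < dist z z' := dist_pos.2 hne
    set ρ := min r (min (dist z z' / 2) (ε / 2)) with hρ
    have hρ0 : 0 < ρ := by positivity
    obtain ⟨V, hV, hxV, hVs⟩ := (isBasis_countableBasis Z).exists_subset_of_mem_open
      (Metric.mem_ball_self hρ0) Metric.isOpen_ball
    have h1 : ρ ≤ r := min_le_left _ _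
    have h2 : ρ ≤ dist z z' / 2 := (min_le_right _ _).trans (min_le_left _ _)
    have h3 : ρ ≤ ε / 2 := (min_le_right _ _).trans (min_le_right _ _)
    refine ⟨V, hV, hxV, ?_, fun y hy => ?_, fun y hy y' hy' => ?_⟩
    · exact ((closure_mono hVs).trans Metric.closure_ball_subset_closedBall).trans
        ((Metric.closedBall_subset_closedBall h1).trans hrU)
    · have := Metric.mem_ball.1 (hVs hy)
      linarith
    · have a := Metric.mem_ball.1 (hVs hy)
      have b := Metric.mem_ball.1 (hVs hy')
      have := dist_triangle_right y y' x
      linarith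
  obtain ⟨V, hV, hzV, hVU, hVd, hVε⟩ := key z hz
  obtain ⟨W, hW, hzW, hWU, hWd, hWε⟩ := key z' hz'
  refine ⟨V, hV, W, hW, hzV, hzW, hVU, hWU, ?_, hVε, hWε⟩
  rw [disjoint_left]
  intro y hyV hyW
  have h1 : dist y z < dist z z' / 2 := hVd y hyV
  have h2 : dist y z' < dist z z' / 2 := by
    exact hWd y hyW
  have := dist_triangle_left z z' y
  linarith

variable {Z X : Type*} [MetricSpace Z] [CompleteSpace Z] [SecondCountableTopology Z]
  [MeasurableSpace Z] [BorelSpace Z] [TopologicalSpace X] [PolishSpace X] [MeasurableSpace X]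
  [BorelSpace X] {f : Z → X}

theorem analyticSet_exists_ne (hf : Continuous f) {A : Set Z} (hA : AnalyticSet A) :
    AnalyticSet {z' | ∃ z ∈ A, z ≠ z' ∧ f z = f z'} := by
  have h1 : AnalyticSet ({p : Z × Z | p.1 ≠ p.2 ∧ f p.1 = f p.2}) := by
    apply MeasurableSet.analyticSet
    exact (measurableSet_eq_fun measurable_fst measurable_snd).compl.inter
      (measurableSet_eq_fun (hf.measurable.comp measurable_fst) (hf.measurable.comp measurable_snd))
  have h2 : AnalyticSet ((Prod.fst : Z × Z → Z) ⁻¹' A) := hA.preimage continuous_fst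
  have h3 : AnalyticSet (⋂ b : Bool, cond b {p : Z × Z | p.1 ≠ p.2 ∧ f p.1 = f p.2}
      ((Prod.fst : Z × Z → Z) ⁻¹' A)) := AnalyticSet.iInter fun b => by cases b <;> assumption
  rw [← inter_eq_iInter] at h3
  convert h3.image_of_continuous continuous_snd using 1
  ext z'
  simp only [mem_ofPred_eq, mem_image, mem_inter_iff, mem_preimage, Prod.exists, exists_eq_right]
  exact exists_congr fun z => and_comm

/-- An analytic set on which `f` is injective is contained in a Borel set on which it is. -/
theorem exists_measurableSet_injOn (hf : Continuous f) {A : Set Z} (hA : AnalyticSet A)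
    (h : InjOn f A) : ∃ D, A ⊆ D ∧ MeasurableSet D ∧ InjOn f D := by
  obtain ⟨D, hAD, hD, hDm⟩ := hA.measurablySeparable (analyticSet_exists_ne hf hA) <| by
    rw [disjoint_left]
    rintro z' hz' ⟨z, hz, hne, he⟩
    exact hne (h hz hz' he)
  -- `D` contains no point sharing a fibre with a different point of `A`, so `A` can also be
  -- separated from the points sharing a fibre with a different point of `D`.
  obtain ⟨D', hAD', hD', hDm'⟩ :=
    hA.measurablySeparable (analyticSet_exists_ne hf hDm.analyticSet) <| by
      rw [disjoint_left]
      rintro z hz ⟨z', hz', hne, he⟩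
      exact disjoint_left.1 hD ⟨z, hz, hne.symm, he.symm⟩ hz'
  refine ⟨D ∩ D', subset_inter hAD hAD', hDm.inter hDm', fun z hz z' hz' he => ?_⟩
  by_contra hne
  exact disjoint_left.1 hD' ⟨z, hz.1, hne, he⟩ hz'.2

/-- Only countably many pairs of basic open sets compete for `(V, W)`. If all failed, their
witnessing covers could be glued into one showing that the original family is not large. -/
theorem IsLargeFamily.exists_split (hf : Continuous f) {s : Finset ℕ} {U : ℕ → Set Z}
    (hU : ∀ i, IsOpen (U i)) (h : IsLargeFamily f s U) {k j : ℕ} (hk : k ∈ s) (hj : j ∉ s) {ε : ℝ}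
    (hε : 0 < ε) :
    ∃ V W : Set Z, IsOpen V ∧ IsOpen W ∧ closure V ⊆ U k ∧ closure W ⊆ U k ∧ Disjoint V W ∧
      (∀ x ∈ V, ∀ y ∈ V, dist x y ≤ ε) ∧ (∀ x ∈ W, ∀ y ∈ W, dist x y ≤ ε) ∧
      IsLargeFamily f (insert j s) (Function.update (Function.update U k V) j W) := by
  by_contra hcon
  have hkj : k ≠ j := fun e => hj (e ▸ hk)
  let P : Set (Set Z × Set Z) := {p | p ∈ countableBasis Z ×ˢ countableBasis Z ∧
    closure p.1 ⊆ U k ∧ closure p.2 ⊆ U k ∧ Disjoint p.1 p.2 ∧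
    (∀ x ∈ p.1, ∀ y ∈ p.1, dist x y ≤ ε) ∧ ∀ x ∈ p.2, ∀ y ∈ p.2, dist x y ≤ ε}
  have hPc : Countable P :=
    (((countable_countableBasis Z).prod (countable_countableBasis Z)).mono
      fun p hp => hp.1).to_subtype
  have hS : ∀ p : P, ∃ S : ℕ → Set X, (∀ i ∈ s, i ≠ k → MeasurableSet (S i) ∧
      SigmaInjOn f (U i ∩ f ⁻¹' S i)) ∧ (MeasurableSet (S k) ∧ MeasurableSet (S j)) ∧
      SigmaInjOn f (p.1.1 ∩ f ⁻¹' S k) ∧ SigmaInjOn f (p.1.2 ∩ f ⁻¹' S j) ∧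
      ∀ x, x ∈ f '' p.1.1 → x ∈ f '' p.1.2 → (∀ i ∈ s, x ∈ f '' U i) →
        x ∈ S k ∨ x ∈ S j ∨ ∃ i ∈ s, i ≠ k ∧ x ∈ S i := by
    rintro ⟨⟨V, W⟩, ⟨hV, hW⟩, h1, h2, h3, h4, h5⟩
    have : ¬ IsLargeFamily f (insert j s) (Function.update (Function.update U k V) j W) :=
      fun hL => hcon ⟨V, W, isOpen_of_mem_countableBasis hV, isOpen_of_mem_countableBasis hW, h1,
        h2, h3, h4, h5, hL⟩
    obtain ⟨S, hS, hSc⟩ := not_not.1 this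
    have hSk := hS k (Finset.mem_insert_of_mem hk)
    have hSj := hS j (Finset.mem_insert_self _ _)
    rw [Function.update_of_ne hkj, Function.update_self] at hSk
    rw [Function.update_self] at hSj
    refine ⟨S, fun i hi hik => ?_, ⟨hSk.1, hSj.1⟩, hSk.2, hSj.2, fun x hxV hxW hx => ?_⟩
    · have hij : i ≠ j := fun e => hj (e ▸ hi)
      have := hS i (Finset.mem_insert_of_mem hi)
      rwa [Function.update_of_ne hij, Function.update_of_ne hik] at this
    · have hx' : x ∈ ⋂ i ∈ insert j s,
          f '' (Function.update (Function.update U k V) j W i) := by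
        simp only [mem_iInter]
        intro i hi
        rcases Finset.mem_insert.1 hi with rfl | hi
        · rwa [Function.update_self]
        · have hij : i ≠ j := fun e => hj (e ▸ hi)
          rw [Function.update_of_ne hij]
          by_cases hik : i = k
          · subst hik
            rwa [Function.update_self]
          · rw [Function.update_of_ne hik]
            exact hx i hi
      have := hSc hx'
      simp only [mem_iUnion] at this
      obtain ⟨i, hi, hxi⟩ := this
      rcases Finset.mem_insert.1 hi with rfl | hi
      · exact Or.inr (Or.inl hxi)
      · by_cases hik : i = k
        · subst hik
          exact Or.inl hxi
        · exact Or.inr (Or.inr ⟨i, hi, hik, hxi⟩)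
  choose S hSs hSm hSV hSW hScov using hS
  -- The common images left over by the indices other than `k`; only `U k` can still take care of
  -- them.
  let T : Set X := (⋂ i ∈ s, f '' U i) \ ⋃ i ∈ s, ⋃ (_ : i ≠ k), ⋃ p, S p i
  have hTm : AnalyticSet T := by
    have h1 : MeasurableSet (⋃ i ∈ s, ⋃ (_ : i ≠ k), ⋃ p, S p i) :=
      Finset.measurableSet_biUnion _ fun i hi => MeasurableSet.iUnion fun hik =>
        MeasurableSet.iUnion fun p => (hSs p i hi hik).1
    have h2 : AnalyticSet (⋂ i ∈ s, f '' U i) := by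
      have : Nonempty s := ⟨⟨k, hk⟩⟩
      have : AnalyticSet (⋂ i : s, f '' U i) := AnalyticSet.iInter fun i =>
        (hU i).measurableSet.analyticSet.image_of_continuous hf
      simpa [iInter_subtype] using this
    have h3 : AnalyticSet (⋂ b : Bool, cond b (⋂ i ∈ s, f '' U i)
        (⋃ i ∈ s, ⋃ (_ : i ≠ k), ⋃ p, S p i)ᶜ) := AnalyticSet.iInter fun b => by
      cases b
      · exact h1.compl.analyticSet
      · exact h2
    rwa [← inter_eq_iInter] at h3
  let B : Set Z := ⋃ p, (p.1.1 ∩ f ⁻¹' S p k) ∪ (p.1.2 ∩ f ⁻¹' S p j)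
  have hBs : SigmaInjOn f B := SigmaInjOn.iUnion fun p => (hSV p).union (hSW p)
  have hBm : MeasurableSet B := MeasurableSet.iUnion fun p =>
    ((isOpen_of_mem_countableBasis p.2.1.1).measurableSet.inter (hf.measurable (hSm p).1)).union
      ((isOpen_of_mem_countableBasis p.2.1.2).measurableSet.inter (hf.measurable (hSm p).2))
  have hA : AnalyticSet (f ⁻¹' T ∩ (U k \ B)) := by
    have h3 : AnalyticSet (⋂ b : Bool, cond b (f ⁻¹' T) (U k \ B)) :=
      AnalyticSet.iInter fun b => by
        cases b
        · exact ((hU k).measurableSet.diff hBm).analyticSet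
        · exact hTm.preimage hf
    rwa [← inter_eq_iInter] at h3
  -- Two such points in one fibre would be separated by some pair `p`, whose cover then puts one of
  -- them in `B` or their image outside `T`.
  have hinj : InjOn f (f ⁻¹' T ∩ (U k \ B)) := by
    rintro z ⟨hzT, hzU, hzB⟩ z' ⟨-, hzU', hzB'⟩ he
    by_contra hne
    obtain ⟨V, hV, W, hW, hzV, hzW, h1, h2, h3, h4, h5⟩ :=
      exists_countableBasis_small (hU k) hε hzU hzU' hne
    let p : P := ⟨(V, W), ⟨hV, hW⟩, h1, h2, h3, h4, h5⟩
    have hzT1 : ∀ i ∈ s, f z ∈ f '' U i := by simpa using hzT.1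
    rcases hScov p (f z) ⟨z, hzV, rfl⟩ ⟨z', hzW, he.symm⟩ hzT1 with h | h | ⟨i, hi, hik, h⟩
    · exact hzB (mem_iUnion.2 ⟨p, Or.inl ⟨hzV, h⟩⟩)
    · exact hzB' (mem_iUnion.2 ⟨p, Or.inr ⟨hzW, by rwa [he] at h⟩⟩)
    · apply hzT.2
      simp only [mem_iUnion]
      exact ⟨i, hi, hik, p, h⟩
  obtain ⟨D, hAD, hDm, hDinj⟩ := exists_measurableSet_injOn hf hA hinj
  -- `Q` is a Borel set containing `T` over which `U k` lies in `B ∪ D`; it serves as the new `S k`.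
  obtain ⟨Q, hTQ, hQ, hQm⟩ := hTm.measurablySeparable
      (((hU k).measurableSet.diff (hBm.union hDm)).analyticSet.image_of_continuous hf) <| by
    rw [disjoint_left]
    rintro x hxT ⟨z, ⟨hzU, hzBD⟩, rfl⟩
    refine hzBD ?_
    by_cases hzB : z ∈ B
    · exact Or.inl hzB
    · exact Or.inr (hAD ⟨hxT, hzU, hzB⟩)
  refine h ⟨fun i => if i = k then Q else ⋃ p, S p i, fun i hi => ?_, fun x hx => ?_⟩
  · by_cases hik : i = k
    · subst hik
      simp only [if_true]
      refine ⟨hQm, (hBs.union (SigmaInjOn.of_injOn hDm hDinj)).mono ?_⟩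
      rintro z ⟨hzU, hzQ⟩
      by_contra hz
      exact disjoint_left.1 hQ ⟨z, ⟨hzU, hz⟩, rfl⟩ hzQ
    · simp only [if_neg hik]
      refine ⟨MeasurableSet.iUnion fun p => (hSs p i hi hik).1, ?_⟩
      rw [preimage_iUnion, inter_iUnion]
      exact SigmaInjOn.iUnion fun p => (hSs p i hi hik).2
  · simp only [mem_iUnion]
    by_cases hxT : x ∈ T
    · exact ⟨k, hk, by simpa using hTQ hxT⟩
    · have : x ∈ ⋃ i ∈ s, ⋃ (_ : i ≠ k), ⋃ p, S p i := by
        by_contra h'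
        exact hxT ⟨hx, h'⟩
      simp only [mem_iUnion] at this
      obtain ⟨i, hi, hik, p, hp⟩ := this
      refine ⟨i, hi, ?_⟩
      rw [if_neg hik]
      exact mem_iUnion.2 ⟨p, hp⟩

/-- A sequence of finite families of open sets, in which the members of each family are split
again and again, and whose images have a common point at each stage, yields a fibre containing
a copy of the Cantor space. -/
theorem exists_not_countable_fiber {Z X : Type*} [MetricSpace Z] [CompleteSpace Z]
    [TopologicalSpace X] [T2Space X] {f : Z → X} (hf : Continuous f) {U : ℕ → ℕ → Set Z}
    (hne : ∀ n, (⋂ i ∈ Finset.range (n + 1), f '' U n i).Nonempty)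
    (hanti : ∀ n, ∀ i ≤ n, U (n + 1) i ⊆ U n i)
    (hcl : ∀ n, closure (U (n + 1) n.unpair.1) ⊆ U n n.unpair.1)
    (hcl' : ∀ n, U (n + 1) (n + 1) ⊆ U n n.unpair.1)
    (hdisj : ∀ n, Disjoint (U (n + 1) n.unpair.1) (U (n + 1) (n + 1)))
    (hdiam : ∀ n, ∀ x ∈ U (n + 1) n.unpair.1, ∀ y ∈ U (n + 1) n.unpair.1,
      dist x y ≤ (1 / 2) ^ n) :
    ∃ x, ¬ (f ⁻¹' {x}).Countable := by
  have hmono : ∀ i n m, i ≤ n → n ≤ m → U m i ⊆ U n i := by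
    intro i n m hin hnm
    induction m, hnm using Nat.le_induction with
    | base => exact Subset.rfl
    | succ m hm ih => exact (hanti m i (hin.trans hm)).trans ih
  -- The first coordinate of unpairing takes each value infinitely often, so every member is split
  -- infinitely often.
  have hpair : ∀ i m : ℕ, ∃ N, m ≤ N ∧ i ≤ N ∧ N.unpair.1 = i := fun i m =>
    ⟨Nat.pair i m, Nat.right_le_pair i m, Nat.left_le_pair i m, by simp⟩
  choose x hx using hne
  have hz : ∀ n i, ∃ z, i ≤ n → z ∈ U n i ∧ f z = x n := by
    intro n i
    by_cases hin : i ≤ n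
    · have := hx n
      simp only [mem_iInter] at this
      obtain ⟨z, hz, hfz⟩ := this i (Finset.mem_range.2 (by omega))
      exact ⟨z, fun _ => ⟨hz, hfz⟩⟩
    · obtain ⟨z, -⟩ := mem_iInter₂.1 (hx 0) 0 (by simp)
      exact ⟨z, fun h => absurd h hin⟩
  choose z hz using hz
  have hdist : ∀ (ε : ℝ), 0 < ε → ∀ i m, ∃ N, m ≤ N ∧ i ≤ N ∧ N.unpair.1 = i ∧
      ∀ a ∈ U (N + 1) i, ∀ b ∈ U (N + 1) i, dist a b < ε := by
    intro ε hε i m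
    obtain ⟨n, hn⟩ := exists_pow_lt_of_lt_one hε (by norm_num : (1 / 2 : ℝ) < 1)
    obtain ⟨N, h1, h2, h3⟩ := hpair i (max m n)
    refine ⟨N, (le_max_left _ _).trans h1, h2, h3, fun a ha b hb => ?_⟩
    have h4 := hdiam N
    rw [h3] at h4
    refine (h4 a ha b hb).trans_lt (lt_of_le_of_lt ?_ hn)
    exact pow_le_pow_of_le_one (by norm_num) (by norm_num) ((le_max_right _ _).trans h1)
  have hlim : ∀ i, ∃ w, Tendsto (fun n => z n i) atTop (𝓝 w) := by
    intro i
    refine cauchySeq_tendsto_of_complete (Metric.cauchySeq_iff.2 fun ε hε => ?_)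
    obtain ⟨N, -, h2, h3, h4⟩ := hdist ε hε i 0
    exact ⟨N + 1, fun m hm n hn =>
      h4 _ (hmono i (N + 1) m (by omega) hm (hz m i (by omega)).1)
        _ (hmono i (N + 1) n (by omega) hn (hz n i (by omega)).1)⟩
  choose w hw using hlim
  have hwU : ∀ i n, i ≤ n → w i ∈ U n i := by
    intro i n hin
    obtain ⟨N, h1, h2, h3⟩ := hpair i n
    have h4 := hcl N
    rw [h3] at h4
    refine hmono i n N hin h1 (h4 ?_)
    refine mem_closure_of_tendsto (hw i) (eventually_atTop.2 ⟨N + 1, fun m hm => ?_⟩)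
    exact hmono i (N + 1) m (by omega) hm (hz m i (by omega)).1
  have hfw : ∀ i, f (w i) = f (w 0) := by
    intro i
    refine tendsto_nhds_unique (((hf.tendsto _).comp (hw i)).congr' ?_)
      ((hf.tendsto _).comp (hw 0))
    refine eventually_atTop.2 ⟨i, fun n hn => ?_⟩
    simp only [Function.comp_apply]
    rw [(hz n i hn).2, (hz n 0 (Nat.zero_le _)).2]
  -- Each late split of member `i` produces a new limit point close to `w i`, and distinct from it
  -- because the two halves are disjoint.
  have hpre : Preperfect (range w) := by
    rw [preperfect_iff_nhds]
    rintro _ ⟨i, rfl⟩ O hO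
    obtain ⟨ε, hε, hεO⟩ := Metric.mem_nhds_iff.1 hO
    obtain ⟨N₀, -, h2, h3, h4⟩ := hdist ε hε i 0
    obtain ⟨N, h5, h6, h7⟩ := hpair i (N₀ + 1)
    have h8 : w (N + 1) ∈ U (N + 1) (N + 1) := hwU _ _ le_rfl
    have h9 := hcl' N
    have h10 := hdisj N
    rw [h7] at h9 h10
    refine ⟨w (N + 1), ⟨hεO ?_, mem_range_self _⟩, fun he => ?_⟩
    · exact h4 _ (hmono i (N₀ + 1) N (by omega) h5 (h9 h8)) _ (hwU i (N₀ + 1) (by omega))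
    · exact disjoint_left.1 h10 (hwU i (N + 1) (by omega)) (he ▸ h8)
  obtain ⟨g, hg, -, hginj⟩ := hpre.perfect_closure.exists_nat_bool_injection
    ((range_nonempty w).mono subset_closure)
  refine ⟨f (w 0), fun hc => ?_⟩
  have hsub : range g ⊆ f ⁻¹' {f (w 0)} :=
    hg.trans <| closure_minimal (range_subset_iff.2 hfw) (isClosed_singleton.preimage hf)
  have : Countable (ℕ → Bool) := by
    have h1 : Countable (range g) := (hc.mono hsub).to_subtype
    exact (Equiv.ofInjective g hginj).injective.countable
  refine absurd (Cardinal.mk_le_aleph0_iff.2 this) (not_le.2 ?_)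
  rw [← Cardinal.power_def, Cardinal.mk_bool, Cardinal.mk_nat]
  exact Cardinal.cantor _

/-- Otherwise the one-member family `univ` is large, and repeated use of `exists_split` feeds
`exists_not_countable_fiber`. -/
theorem sigmaInjOn_univ_of_continuous (hf : Continuous f) (hc : ∀ x, (f ⁻¹' {x}).Countable) :
    SigmaInjOn f univ := by
  by_contra hcon
  let P : ℕ → (ℕ → Set Z) → Prop := fun n U =>
    (∀ i, IsOpen (U i)) ∧ IsLargeFamily f (Finset.range (n + 1)) U
  have h0 : P 0 fun _ => univ := by
    refine ⟨fun _ => isOpen_univ, fun ⟨S, hS, hcov⟩ => hcon ((hS 0 (by simp)).2.mono ?_)⟩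
    intro z _
    have : f z ∈ ⋂ i ∈ Finset.range (0 + 1), f '' (univ : Set Z) := by simp
    simpa using hcov this
  have hstep : ∀ n (U : {U // P n U}), ∃ U' : {U // P (n + 1) U},
      (∀ i ≤ n, U'.1 i ⊆ U.1 i) ∧ closure (U'.1 n.unpair.1) ⊆ U.1 n.unpair.1 ∧
      U'.1 (n + 1) ⊆ U.1 n.unpair.1 ∧ Disjoint (U'.1 n.unpair.1) (U'.1 (n + 1)) ∧
      ∀ x ∈ U'.1 n.unpair.1, ∀ y ∈ U'.1 n.unpair.1, dist x y ≤ (1 / 2) ^ n := by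
    rintro n ⟨U, hUo, hUl⟩
    have hk : n.unpair.1 ≤ n := Nat.unpair_left_le n
    obtain ⟨V, W, hVo, hWo, hV, hW, hd, hVd, -, hl⟩ := hUl.exists_split hf hUo
      (k := n.unpair.1) (j := n + 1) (Finset.mem_range.2 (by omega)) (by simp)
      (ε := (1 / 2) ^ n) (by positivity)
    rw [← Finset.range_add_one] at hl
    have hkn : n.unpair.1 ≠ n + 1 := by omega
    refine ⟨⟨Function.update (Function.update U n.unpair.1 V) (n + 1) W, ?_, hl⟩, ?_, ?_⟩
    · intro i
      by_cases h1 : i = n + 1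
      · subst h1; simpa using hWo
      · rw [Function.update_of_ne h1]
        by_cases h2 : i = n.unpair.1
        · subst h2; simpa using hVo
        · rw [Function.update_of_ne h2]; exact hUo i
    · intro i hi
      simp only
      rw [Function.update_of_ne (by omega)]
      by_cases h2 : i = n.unpair.1
      · subst h2
        rw [Function.update_self]
        exact subset_closure.trans hV
      · rw [Function.update_of_ne h2]
    · simp only [Function.update_self, Function.update_of_ne hkn]
      exact ⟨hV, subset_closure.trans hW, hd, hVd⟩
  choose next hnext using hstep
  let U : ∀ n, {U // P n U} := fun n => Nat.rec ⟨_, h0⟩ next n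
  have hU : ∀ n, U (n + 1) = next n (U n) := fun _ => rfl
  obtain ⟨x, hx⟩ := exists_not_countable_fiber hf (U := fun n => (U n).1)
    (fun n => (U n).2.2.nonempty)
    (fun n => (hU n) ▸ (hnext n (U n)).1) (fun n => (hU n) ▸ (hnext n (U n)).2.1)
    (fun n => (hU n) ▸ (hnext n (U n)).2.2.1) (fun n => (hU n) ▸ (hnext n (U n)).2.2.2.1)
    (fun n => (hU n) ▸ (hnext n (U n)).2.2.2.2)
  exact hx (hc x)

/-- **Lusin–Novikov**: the domain of a countable-to-one Borel map between standard Borel spaces is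
the union of countably many Borel sets on which the map is injective. -/
theorem sigmaInjOn_univ_of_measurable {Z X : Type*} [MeasurableSpace Z] [StandardBorelSpace Z]
    [MeasurableSpace X] [StandardBorelSpace X] {f : Z → X} (hf : Measurable f)
    (hc : ∀ x, (f ⁻¹' {x}).Countable) : SigmaInjOn f univ := by
  obtain ⟨τZ, hτZ, hpZ⟩ := ‹StandardBorelSpace Z›.polish
  obtain ⟨τX, _, _⟩ := ‹StandardBorelSpace X›.polish
  -- A finer Polish topology makes `f` continuous without changing the Borel sets.
  obtain ⟨τ, hle, hfc, hτ⟩ := hf.exists_continuous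
  have hB : @BorelSpace Z τ _ := ⟨by
    rw [@borel_eq_borel_of_le Z τ τZ hτ hpZ hle]
    exact hτZ.measurable_eq⟩
  let := τ
  let := upgradeIsCompletelyMetrizable Z
  exact sigmaInjOn_univ_of_continuous hfc hc

end LusinNovikov

/-! ### Pulling back structures, and Borel enumerations of classes -/

section Transfer

open Set MeasureTheory

/-- Truth is invariant under bijections that preserve and reflect the relations. -/
theorem InfFormula.realize_comp_equiv {L : FirstOrder.Language.{0, 0}} {M N : Type*}
    (S : L.Structure M) (S' : L.Structure N) (e : M ≃ N)
    (h : ∀ (k : ℕ) (R : L.Relations k) (x : Fin k → M), S.RelMap R x ↔ S'.RelMap R (e ∘ x))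
    {n : ℕ} (φ : InfFormula L n) (x : Fin n → M) :
    φ.Realize S x ↔ φ.Realize S' (e ∘ x) := by
  induction φ with
  | falsum => exact Iff.rfl
  | equal i j => simp [InfFormula.Realize]
  | rel R t => exact h _ R _
  | imp φ ψ ih₁ ih₂ => exact imp_congr (ih₁ x) (ih₂ x)
  | conj φ ih => exact forall_congr' fun i => ih i x
  | all φ ih =>
    simp only [InfFormula.Realize, ih]
    exact ⟨fun H b => by simpa [Fin.comp_snoc] using H (e.symm b),
      fun H a => by simpa [Fin.comp_snoc] using H (e a)⟩

namespace CBER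

theorem mem_cls_self (E : CBER.{u}) (x : E.carrier) : x ∈ E.cls x := E.equivalence.refl x

theorem rel_of_mem_cls (E : CBER.{u}) {x y z : E.carrier} (hy : y ∈ E.cls x) (hz : z ∈ E.cls x) :
    E.rel y z := E.equivalence.trans (E.equivalence.symm hy) hz

theorem measurableSet_rel_of_measurable (E : CBER.{u}) {Ω : Type*} [MeasurableSpace Ω]
    {f g : Ω → E.carrier} (hf : Measurable f) (hg : Measurable g) :
    MeasurableSet {ω | E.rel (f ω) (g ω)} :=
  (hf.prodMk hg) E.measurableSet_rel

/-- A class-bijective map that respects structures within each class transfers models. -/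
theorem IsClassBijective.models_restrict_iff {E F : CBER.{u}} {f : E.carrier → F.carrier}
    (hf : IsClassBijective E F f) (T : InfTheory) {S : T.lang.Structure E.carrier}
    {S' : T.lang.Structure F.carrier}
    (h : ∀ (k : ℕ) (R : T.lang.Relations k) (x : Fin k → E.carrier),
      (∀ i j, E.rel (x i) (x j)) → (S.RelMap R x ↔ S'.RelMap R (f ∘ x))) (x : E.carrier) :
    T.Models (restrict T.relational S (E.cls x)) ↔
      T.Models (restrict T.relational S' (F.cls (f x))) := by
  unfold InfTheory.Models
  rw [InfFormula.realize_comp_equiv (restrict T.relational S (E.cls x))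
    (restrict T.relational S' (F.cls (f x))) ((hf.2 x).equiv f)]
  · rw [Subsingleton.elim (_ ∘ _) Fin.elim0]
  · intro k R y
    exact h k R (fun i => (y i : E.carrier)) fun i j => E.rel_of_mem_cls (y i).2 (y j).2

/-- Relations are pulled back and cut down to tuples within one class. Models are required only on
classes met by `f`, so the lemma also applies to the inclusion of an invariant set of good points.
-/
theorem IsClassBijective.structurable {E F : CBER.{u}} {f : E.carrier → F.carrier}
    (hf : IsClassBijective E F f) {T : InfTheory} {S : T.lang.Structure F.carrier}
    (hS : F.IsBorelStructureOn S)
    (hmod : ∀ x, T.Models (restrict T.relational S (F.cls (f x)))) : E.Structurable T := by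
  let S₀ : T.lang.Structure E.carrier :=
    { funMap := fun {n} g _ => ((T.relational n).false g).elim
      RelMap := fun R x => (∀ i j, E.rel (x i) (x j)) ∧ S.RelMap R (f ∘ x) }
  refine ⟨S₀, fun n R => ⟨?_, fun _ hx => hx.1⟩, fun x => ?_⟩
  · refine MeasurableSet.inter (s₁ := {x : Fin n → E.carrier | ∀ i j, E.rel (x i) (x j)})
      (s₂ := {x : Fin n → E.carrier | S.RelMap R (f ∘ x)}) ?_ ?_
    · simp only [ofPred_forall]
      exact MeasurableSet.iInter fun i => MeasurableSet.iInter fun j =>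
        E.measurableSet_rel_of_measurable (measurable_pi_apply i) (measurable_pi_apply j)
    · exact (measurable_pi_lambda (fun x : Fin n → E.carrier => f ∘ x)
        fun i => hf.1.1.comp (measurable_pi_apply i)) (hS n R).1
  · exact (hf.models_restrict_iff T (S := S₀) (S' := S)
      (fun k R y hy => ⟨fun h => h.2, fun h => ⟨hy, h⟩⟩) x).2 (hmod x)

theorem ClassBijects.structurable {E F : CBER.{u}} (h : E.ClassBijects F) {T : InfTheory}
    (hF : F.Structurable T) : E.Structurable T :=
  let ⟨_, hf⟩ := h
  let ⟨_, hS, hmod⟩ := hF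
  hf.structurable hS fun _ => hmod _

theorem InvEmbeds.classBijects {E F : CBER.{u}} (h : E.InvEmbeds F) : E.ClassBijects F :=
  let ⟨f, hf, _⟩ := h
  ⟨f, hf⟩

/-- A countable Borel equivalence relation is the union of countably many graphs of Borel partial
functions. -/
theorem exists_graphs (E : CBER.{u}) : ∃ B : ℕ → Set (E.carrier × E.carrier),
    (∀ n, MeasurableSet (B n) ∧ InjOn Prod.fst (B n)) ∧
    ∀ x y, E.rel x y ↔ ∃ n, (x, y) ∈ B n := by
  let D : Set (E.carrier × E.carrier) := {p | E.rel p.1 p.2}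
  have : StandardBorelSpace D := E.measurableSet_rel.standardBorel
  obtain ⟨B, hB, hcov⟩ := sigmaInjOn_univ_of_measurable (Z := D) (f := fun p => p.1.1)
    (measurable_fst.comp measurable_subtype_coe) fun x => by
      refine MapsTo.countable_of_injOn (f := fun p : D => p.1.2) (t := {y | E.rel x y})
        ?_ ?_ (E.countable_class x)
      · rintro ⟨⟨a, b⟩, hp⟩ rfl
        exact hp
      · rintro ⟨⟨a, b⟩, hp⟩ rfl ⟨⟨a', b'⟩, hp'⟩ h h'
        simp only [mem_preimage, mem_singleton_iff] at h h'
        subst h h'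
        rfl
  refine ⟨fun n => Subtype.val '' B n, fun n => ⟨E.measurableSet_rel.subtype_image (hB n).1, ?_⟩,
    fun x y => ⟨fun h => ?_, ?_⟩⟩
  · rintro _ ⟨p, hp, rfl⟩ _ ⟨q, hq, rfl⟩ h
    rw [(hB n).2 hp hq h]
  · obtain ⟨n, hn⟩ := mem_iUnion.1 (hcov (mem_univ (⟨(x, y), h⟩ : D)))
    exact ⟨n, _, hn, rfl⟩
  · rintro ⟨n, p, -, hp⟩
    have := p.2
    rw [hp] at this
    exact this

/-- The classes of a countable Borel equivalence relation are enumerated by a sequence of Borel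
functions. -/
theorem exists_enumeration (E : CBER.{u}) : ∃ g : ℕ → E.carrier → E.carrier,
    (∀ n, Measurable (g n)) ∧ ∀ x y, E.rel x y ↔ ∃ n, g n x = y := by
  classical
  obtain ⟨B, hB, hrel⟩ := E.exists_graphs
  -- The default value `x` makes the partial function total without leaving the class.
  let g : ℕ → E.carrier → E.carrier := fun n x => if h : ∃ y, (x, y) ∈ B n then h.choose else x
  have hg : ∀ n x y, (x, y) ∈ B n → g n x = y := by
    intro n x y hy
    have h : ∃ y, (x, y) ∈ B n := ⟨y, hy⟩
    have := (hB n).2 h.choose_spec hy rfl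
    simp only [g, dif_pos h]
    exact (Prod.ext_iff.1 this).2
  refine ⟨g, fun n C hC => ?_, fun x y => ⟨fun h => ?_, ?_⟩⟩
  -- Both projections are Borel, by Lusin–Souslin, since `Prod.fst` is injective on `B n`.
  · have : g n ⁻¹' C = Prod.fst '' (B n ∩ Prod.snd ⁻¹' C) ∪ ((Prod.fst '' B n)ᶜ ∩ C) := by
      ext x
      by_cases h : ∃ y, (x, y) ∈ B n
      · obtain ⟨y, hy⟩ := h
        have hx : x ∈ Prod.fst '' B n := ⟨_, hy, rfl⟩
        simp only [mem_preimage, hg n x y hy, mem_union, mem_inter_iff, mem_compl_iff, hx,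
          not_true_eq_false, false_and, or_false]
        refine ⟨fun hyC => ⟨(x, y), ⟨hy, hyC⟩, rfl⟩, ?_⟩
        rintro ⟨⟨x', y'⟩, ⟨h1, h2⟩, rfl⟩
        rwa [← hg n _ y hy, hg n _ y' h1]
      · have hx : x ∉ Prod.fst '' B n := fun ⟨p, hp, hpx⟩ => h ⟨p.2, hpx ▸ hp⟩
        have hx' : x ∉ Prod.fst '' (B n ∩ Prod.snd ⁻¹' C) :=
          fun ⟨p, hp, hpx⟩ => hx ⟨p, hp.1, hpx⟩
        simp [mem_preimage, g, dif_neg h, hx, hx']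
    rw [this]
    refine (MeasurableSet.image_of_measurable_injOn ((hB n).1.inter (measurable_snd hC))
      measurable_fst ((hB n).2.mono inter_subset_left)).union (MeasurableSet.inter ?_ hC)
    exact ((hB n).1.image_of_measurable_injOn measurable_fst (hB n).2).compl
  · obtain ⟨n, hn⟩ := (hrel x y).1 h
    exact ⟨n, hg n x y hn⟩
  · rintro ⟨n, rfl⟩
    by_cases h : ∃ y, (x, y) ∈ B n
    · simp only [g, dif_pos h]
      exact (hrel _ _).2 ⟨n, h.choose_spec⟩
    · simp only [g, dif_neg h]
      exact E.equivalence.refl x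

end CBER

end Transfer

/-! ### Borel satisfaction, shifts and universal structured relations -/

section Universal

open Set MeasureTheory

namespace CBER

/-- Satisfaction of a formula in the class of a point is a Borel property of the point. -/
theorem measurableSet_realize (E : CBER.{u}) {ι : Type*} [Countable ι]
    {g : ι → E.carrier → E.carrier} (hg : ∀ i, Measurable (g i))
    (hrel : ∀ x y, E.rel x y ↔ ∃ i, g i x = y) {L : FirstOrder.Language.{0, 0}}
    (hL : L.IsRelational) {S : L.Structure E.carrier} (hS : E.IsBorelStructureOn S) {n : ℕ}
    (φ : InfFormula L n) (a : Fin n → ι) :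
    MeasurableSet {x | φ.Realize (restrict hL S (E.cls x))
      ((fun i => ⟨g i x, (hrel x _).2 ⟨i, rfl⟩⟩) ∘ a)} := by
  induction φ with
  | falsum => exact MeasurableSet.empty
  | equal i j =>
    simp only [InfFormula.Realize, Function.comp_apply, Subtype.ext_iff]
    exact measurableSet_eq_fun (hg _) (hg _)
  | rel R t =>
    exact (measurable_pi_lambda (fun x k => g (a (t k)) x) fun k => hg _) (hS _ R).1
  | imp φ ψ ih₁ ih₂ =>
    simp only [InfFormula.Realize]
    exact (ih₁ a).imp (ih₂ a)
  | conj φ ih =>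
    simp only [InfFormula.Realize, ofPred_forall]
    exact MeasurableSet.iInter fun i => ih i a
  | all φ ih =>
    -- Since `g` enumerates the class, the quantifier over it becomes a countable intersection.
    have := MeasurableSet.iInter fun m => ih (Fin.snoc a m)
    convert this using 1
    ext x
    simp only [InfFormula.Realize, mem_ofPred_eq, mem_iInter, Fin.comp_snoc]
    constructor
    · exact fun H m => H _
    · rintro H ⟨y, hy⟩
      obtain ⟨m, rfl⟩ := (hrel x y).1 hy
      exact H m

theorem measurableSet_models (E : CBER.{u}) (T : InfTheory) {S : T.lang.Structure E.carrier}
    (hS : E.IsBorelStructureOn S) :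
    MeasurableSet {x | T.Models (restrict T.relational S (E.cls x))} := by
  obtain ⟨g, hg, hrel⟩ := E.exists_enumeration
  convert E.measurableSet_realize hg hrel T.relational hS T.sentence Fin.elim0 using 4
  rw [Subsingleton.elim (_ ∘ _) Fin.elim0, InfTheory.Models]

/-- The restriction of a countable Borel equivalence relation to a Borel set. -/
def onSet (E : CBER.{u}) (A : Set E.carrier) (hA : MeasurableSet A) : CBER.{u} where
  carrier := A
  measurableSpace := inferInstance
  standardBorel := hA.standardBorel
  rel x y := E.rel x y
  equivalence := ⟨fun x => E.equivalence.refl x, fun h => E.equivalence.symm h,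
    fun h h' => E.equivalence.trans h h'⟩
  measurableSet_rel := E.measurableSet_rel_of_measurable
    (measurable_subtype_coe.comp measurable_fst) (measurable_subtype_coe.comp measurable_snd)
  countable_class x := (E.countable_class x).preimage Subtype.val_injective

theorem isClassBijective_val (E : CBER.{u}) {A : Set E.carrier} (hA : MeasurableSet A)
    (hinv : ∀ x y, E.rel x y → x ∈ A → y ∈ A) :
    IsClassBijective (E.onSet A hA) E (Subtype.val : A → E.carrier) :=
  ⟨⟨measurable_subtype_coe, fun _ _ h => h⟩, fun x =>
    ⟨fun _ hy => hy, Subtype.val_injective.injOn, fun y hy => ⟨⟨y, hinv _ _ hy x.2⟩, hy, rfl⟩⟩⟩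

/-- An invariant embedding whose range lies in a Borel set is one into the restriction
to that set. -/
theorem invEmbeds_onSet {E F : CBER.{u}} {A : Set F.carrier} (hA : MeasurableSet A)
    {f : E.carrier → F.carrier}
    (hf : IsClassBijective E F f) (hr : IsReduction E F f) (hfA : ∀ x, f x ∈ A) :
    E.InvEmbeds (F.onSet A hA) := by
  have hom : IsHom E (F.onSet A hA) fun x => (⟨f x, hfA x⟩ : A) :=
    ⟨hf.1.1.subtype_mk, fun x y h => hf.1.2 x y h⟩
  refine ⟨fun x => (⟨f x, hfA x⟩ : A), ⟨hom, fun x => ⟨fun y hy => hf.1.2 x y hy, ?_, ?_⟩⟩, hom,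
    fun x y h => hr.2 x y h⟩
  · intro y hy z hz h
    exact (hf.2 x).2.1 hy hz (congrArg Subtype.val h)
  · rintro ⟨y, hyA⟩ hy
    obtain ⟨z, hz, rfl⟩ := (hf.2 x).2.2 hy
    exact ⟨z, hz, rfl⟩

end CBER

/-! ### Shift of a free monoid -/

/-- The free monoid on countably many generators. -/
abbrev ShiftMonoid : Type u := FreeMonoid (ULift.{u} ℕ)

instance : Countable ShiftMonoid.{u} := inferInstanceAs (Countable (List (ULift.{u} ℕ)))

/-- The shift action of the free monoid on labellings of its elements. -/
def shift {J : Type u} (m : ShiftMonoid.{u}) (w : ShiftMonoid.{u} → J → Bool) :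
    ShiftMonoid.{u} → J → Bool := fun k => w (k * m)

theorem shift_one {J : Type u} (w : ShiftMonoid.{u} → J → Bool) : shift 1 w = w := by
  funext k
  simp [shift]

theorem shift_shift {J : Type u} (m m' : ShiftMonoid.{u}) (w : ShiftMonoid.{u} → J → Bool) :
    shift m (shift m' w) = shift (m * m') w := by
  funext k
  simp [shift, mul_assoc]

theorem measurable_shift {J : Type u} (m : ShiftMonoid.{u}) :
    Measurable (shift (J := J) m) :=
  measurable_pi_lambda _ fun _ => measurable_pi_apply _

/-- The part of the shift where every move can be undone. -/
def reversiblePart (J : Type u) : Set (ShiftMonoid.{u} → J → Bool) :=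
  {w | ∀ m, ∃ k, shift k (shift m w) = w}

theorem measurableSet_reversiblePart (J : Type u) [Countable J] :
    MeasurableSet (reversiblePart J) := by
  simp only [reversiblePart, ofPred_forall, ofPred_exists]
  exact MeasurableSet.iInter fun m => MeasurableSet.iUnion fun k =>
    measurableSet_eq_fun ((measurable_shift k).comp (measurable_shift m)) measurable_id

theorem shift_mem_reversiblePart {J : Type u} {w : ShiftMonoid.{u} → J → Bool}
    (hw : w ∈ reversiblePart J) (m : ShiftMonoid.{u}) : shift m w ∈ reversiblePart J := by
  intro m'
  obtain ⟨k, hk⟩ := hw (m' * m)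
  -- `k` leads from `m' * m` back to `w`, and `m` then returns to `shift m w`.
  refine ⟨m * k, ?_⟩
  rw [shift_shift m' m, ← shift_shift m k, hk]

/-- The orbit equivalence relation of the shift. -/
def shiftCBER (J : Type u) [Countable J] : CBER.{u} where
  carrier := reversiblePart J
  measurableSpace := inferInstance
  standardBorel := (measurableSet_reversiblePart J).standardBorel
  rel w w' := ∃ m, shift m w.1 = w'.1
  equivalence := by
    refine ⟨fun w => ⟨1, shift_one _⟩, ?_, ?_⟩
    · rintro w w' ⟨m, hm⟩
      rw [← hm]
      exact w.2 m
    · rintro w w' w'' ⟨m, hm⟩ ⟨m', hm'⟩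
      exact ⟨m' * m, by rw [← shift_shift, hm, hm']⟩
  measurableSet_rel := by
    simp only [ofPred_exists]
    exact MeasurableSet.iUnion fun m => measurableSet_eq_fun
      ((measurable_shift m).comp (measurable_subtype_coe.comp measurable_fst))
      (measurable_subtype_coe.comp measurable_snd)
  countable_class w := by
    refine (countable_range fun m =>
      (⟨shift m w.1, shift_mem_reversiblePart w.2 m⟩ : reversiblePart J)).mono ?_
    rintro w' ⟨m, hm⟩
    exact ⟨m, Subtype.ext hm⟩

/-- The action of the free monoid given by a sequence of maps. -/
def wordAct {X : Type*} (g : ℕ → X → X) (m : ShiftMonoid.{u}) : X → X :=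
  (FreeMonoid.lift fun n => g n.down : ShiftMonoid.{u} →* Function.End X) m

section WordAct

variable {X : Type*} {g : ℕ → X → X}

theorem wordAct_one (x : X) : wordAct g 1 x = x := rfl

theorem wordAct_mul (m m' : ShiftMonoid.{u}) (x : X) :
    wordAct g (m * m') x = wordAct g m (wordAct g m' x) := by
  rw [wordAct, map_mul]
  rfl

theorem wordAct_of (n : ULift.{u} ℕ) (x : X) : wordAct g (FreeMonoid.of n) x = g n.down x :=
  congrFun (FreeMonoid.lift_eval_of (M := Function.End X)
    (fun n : ULift.{u} ℕ => (g n.down : Function.End X)) n) x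

theorem measurable_wordAct [MeasurableSpace X] (hg : ∀ n, Measurable (g n))
    (m : ShiftMonoid.{u}) : Measurable (wordAct g m) := by
  induction m using FreeMonoid.inductionOn' with
  | one => exact measurable_id
  | of_mul n m ih =>
    simp only [funext fun x => wordAct_mul (g := g) (FreeMonoid.of n) m x, wordAct_of]
    exact (hg n.down).comp ih

theorem rel_iff_exists_wordAct {E : CBER.{u}} {g : ℕ → E.carrier → E.carrier}
    (hrel : ∀ x y, E.rel x y ↔ ∃ n, g n x = y) (x y : E.carrier) :
    E.rel x y ↔ ∃ m : ShiftMonoid.{u}, wordAct g m x = y := by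
  constructor
  · intro h
    obtain ⟨n, hn⟩ := (hrel x y).1 h
    exact ⟨FreeMonoid.of ⟨n⟩, by rw [wordAct_of, hn]⟩
  · rintro ⟨m, rfl⟩
    induction m using FreeMonoid.inductionOn' with
    | one => rw [wordAct_one]; exact E.equivalence.refl x
    | of_mul n m ih =>
      rw [wordAct_mul, wordAct_of]
      exact E.equivalence.trans ih ((hrel _ _).2 ⟨_, rfl⟩)

end WordAct

/-- The labelling of the free monoid that a point induces. -/
def orbitLabelling {X : Type u} {J : Type u} (g : ℕ → X → X) (l : X → J → Bool) (x : X) :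
    ShiftMonoid.{u} → J → Bool := fun m => l (wordAct g m x)

theorem shift_orbitLabelling {X : Type u} {J : Type u} (g : ℕ → X → X) (l : X → J → Bool)
    (m : ShiftMonoid.{u}) (x : X) :
    shift m (orbitLabelling g l x) = orbitLabelling g l (wordAct g m x) := by
  funext k
  simp only [shift, orbitLabelling, wordAct_mul]

theorem orbitLabelling_injective {X : Type u} {J : Type u} {g : ℕ → X → X} {l : X → J → Bool}
    (hl : Function.Injective l) : Function.Injective (orbitLabelling g l) := by
  intro x y h
  have := congrFun h 1
  simp only [orbitLabelling, wordAct_one] at this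
  exact hl this

section Embedding

variable {E : CBER.{u}} {J : Type u} {g : ℕ → E.carrier → E.carrier}

theorem orbitLabelling_mem_reversiblePart (hrel : ∀ x y, E.rel x y ↔ ∃ n, g n x = y)
    (l : E.carrier → J → Bool) (x : E.carrier) :
    orbitLabelling g l x ∈ reversiblePart J := by
  intro m
  obtain ⟨k, hk⟩ := (rel_iff_exists_wordAct hrel _ _).1
    (E.equivalence.symm ((rel_iff_exists_wordAct hrel _ _).2 ⟨m, rfl⟩ : E.rel x (wordAct g m x)))
  exact ⟨k, by rw [shift_orbitLabelling, shift_orbitLabelling, hk]⟩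

variable [Countable J]

/-- The equivariant map into the shift given by a labelling of the points. -/
def toShift (hrel : ∀ x y, E.rel x y ↔ ∃ n, g n x = y) (l : E.carrier → J → Bool)
    (x : E.carrier) : (shiftCBER J).carrier :=
  ⟨orbitLabelling g l x, orbitLabelling_mem_reversiblePart hrel l x⟩

/-- The map is equivariant, and injective because its coordinate at `1` is `l`; hence it carries
classes bijectively onto shift orbits. -/
theorem isClassBijective_toShift (hg : ∀ n, Measurable (g n))
    (hrel : ∀ x y, E.rel x y ↔ ∃ n, g n x = y) {l : E.carrier → J → Bool} (hlm : Measurable l)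
    (hl : Function.Injective l) :
    CBER.IsClassBijective E (shiftCBER J) (toShift hrel l) ∧
      CBER.IsReduction E (shiftCBER J) (toShift hrel l) := by
  have key : ∀ x y, (∃ m, shift m (orbitLabelling g l x) = orbitLabelling g l y) ↔ E.rel x y := by
    intro x y
    rw [rel_iff_exists_wordAct hrel]
    refine exists_congr fun m => ?_
    rw [shift_orbitLabelling]
    exact (orbitLabelling_injective hl).eq_iff
  have hom : CBER.IsHom E (shiftCBER J) (toShift hrel l) := by
    refine ⟨?_, fun x y h => (key x y).2 h⟩
    have : Measurable (orbitLabelling g l) :=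
      measurable_pi_lambda _ fun m => hlm.comp (measurable_wordAct hg m)
    exact this.subtype_mk
  refine ⟨⟨hom, fun x => ⟨fun y hy => hom.2 x y hy, ?_, ?_⟩⟩, hom, fun x y h => (key x y).1 h⟩
  · intro y _ z _ h
    exact orbitLabelling_injective hl (congrArg Subtype.val h)
  · rintro ⟨w, hw⟩ ⟨m, hm⟩
    refine ⟨wordAct g m x, (rel_iff_exists_wordAct hrel _ _).2 ⟨m, rfl⟩, Subtype.ext ?_⟩
    exact (shift_orbitLabelling g l m x).symm.trans hm

end Embedding

/-! ### The universal structured equivalence relation -/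

section Structured

variable (L : FirstOrder.Language.{0, 0})

/-- The labels of a point: a real that identifies it, and the relations between the points of its
class as seen from it. -/
abbrev LabelIndex : Type u := ℕ ⊕ Σ k, L.Relations k × (Fin k → ShiftMonoid.{u})

theorem countable_labelIndex (h : Countable (Σ n, L.Relations n)) :
    Countable (LabelIndex.{u} L) := by
  have : ∀ k, Countable (L.Relations k) := fun k =>
    (sigma_mk_injective (β := fun n => L.Relations n) (i := k)).countable
  infer_instance

variable {L} [Countable (LabelIndex.{u} L)]

/-- The structure on the shift that the labels describe. -/
@[reducible]
def shiftStructure (hL : L.IsRelational) : L.Structure (shiftCBER (LabelIndex.{u} L)).carrier where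
  funMap {n} f _ := ((hL n).false f).elim
  -- Any entry of the tuple may serve as the base point whose label is consulted; with no entries
  -- the relation would be empty.
  RelMap {k} R x := ∃ (j : Fin k) (m : Fin k → ShiftMonoid.{u}),
    (∀ i, shift (m i) (x j).1 = (x i).1) ∧ (x j).1 1 (Sum.inr ⟨k, R, m⟩) = true

theorem isBorelStructureOn_shiftStructure (hL : L.IsRelational) :
    (shiftCBER (LabelIndex.{u} L)).IsBorelStructureOn (shiftStructure hL) := by
  intro k R
  constructor
  · change MeasurableSet {x : Fin k → (shiftCBER (LabelIndex.{u} L)).carrier |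
      ∃ (j : Fin k) (m : Fin k → ShiftMonoid.{u}),
      (∀ i, shift (m i) (x j).1 = (x i).1) ∧ (x j).1 1 (Sum.inr ⟨k, R, m⟩) = true}
    simp only [ofPred_exists, ofPred_and, ofPred_forall]
    have hval : ∀ i : Fin k, Measurable
        (fun x : Fin k → (shiftCBER (LabelIndex.{u} L)).carrier => (x i).1) :=
      fun i => measurable_subtype_coe.comp (measurable_pi_apply i)
    refine MeasurableSet.iUnion fun j => MeasurableSet.iUnion fun m => MeasurableSet.inter ?_ ?_
    · exact MeasurableSet.iInter fun i =>
        measurableSet_eq_fun ((measurable_shift (m i)).comp (hval j)) (hval i)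
    · exact measurableSet_eq_fun ((measurable_pi_apply _).comp
        ((measurable_pi_apply 1).comp (hval j))) measurable_const
  · rintro x ⟨j, m, hm, -⟩ i i'
    have h : ∀ i, (shiftCBER (LabelIndex.{u} L)).rel (x j) (x i) := fun i => ⟨m i, hm i⟩
    exact (shiftCBER _).equivalence.trans ((shiftCBER _).equivalence.symm (h i)) (h i')

/-- The labelling of the points of a structured equivalence relation. -/
noncomputable def structureLabel {X : Type u} [MeasurableSpace X]
    [MeasurableSpace.CountablyGenerated X] (g : ℕ → X → X) (S : L.Structure X) (x : X) :
    LabelIndex.{u} L → Bool := by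
  classical
  exact Sum.elim (MeasurableSpace.mapNatBool X x) fun r =>
    decide (S.RelMap r.2.1 fun i => wordAct g (r.2.2 i) x)

end Structured

/-- The witness is the shift restricted to the points whose class, with the structure read off the
labels, is a model. A structured `E` lands there because its labels reproduce its own structure. -/
theorem exists_isInvariantlyUniversalIn_structurable (T : InfTheory) :
    ∃ U : CBER.{u}, IsInvariantlyUniversalIn U {E | E.Structurable T} := by
  have := countable_labelIndex.{u} T.lang T.countable_rel
  let W := shiftCBER (LabelIndex.{u} T.lang)
  let S : T.lang.Structure W.carrier := shiftStructure T.relational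
  have hS : W.IsBorelStructureOn S := isBorelStructureOn_shiftStructure T.relational
  let A : Set W.carrier := {x | T.Models (restrict T.relational S (W.cls x))}
  have hA : MeasurableSet A := W.measurableSet_models T hS
  have hinv : ∀ x y, W.rel x y → x ∈ A → y ∈ A := by
    intro x y h hx
    have : W.cls x = W.cls y := by
      ext z
      exact ⟨fun hz => W.equivalence.trans (W.equivalence.symm h) hz,
        fun hz => W.equivalence.trans h hz⟩
    change T.Models _
    rw [← this]
    exact hx
  refine ⟨W.onSet A hA, (W.isClassBijective_val hA hinv).structurable hS fun x => x.2, ?_⟩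
  rintro E ⟨S', hS', hmod⟩
  obtain ⟨g, hg, hrel⟩ := E.exists_enumeration
  let l : E.carrier → LabelIndex.{u} T.lang → Bool := structureLabel g S'
  have hl : Function.Injective l := fun x y h =>
    MeasurableSpace.injective_mapNatBool E.carrier
      (funext fun n => congrFun h (Sum.inl n))
  have hlm : Measurable l := by
    refine measurable_pi_lambda _ ?_
    rintro (n | ⟨k, R, m⟩)
    · exact (measurable_pi_apply n).comp (MeasurableSpace.measurable_mapNatBool E.carrier)
    · refine measurable_to_bool ?_
      have h : Measurable fun (x : E.carrier) (i : Fin k) => wordAct g (m i) x :=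
        measurable_pi_lambda _ fun i => measurable_wordAct hg (m i)
      convert h (hS' k R).1 using 1
      ext x
      simp [l, structureLabel]
  obtain ⟨hcb, hred⟩ := isClassBijective_toShift hg hrel hlm hl
  refine CBER.invEmbeds_onSet hA hcb hred fun x => ?_
  refine (hcb.models_restrict_iff T (S := S') (S' := S) ?_ x).1 (hmod x)
  intro k R y hy
  have hlab : ∀ (j : Fin k) (m : Fin k → ShiftMonoid.{u}),
      (toShift hrel l (y j)).1 1 (Sum.inr ⟨k, R, m⟩) = true ↔
        S'.RelMap R fun i => wordAct g (m i) (y j) := by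
    intro j m
    simp only [toShift, orbitLabelling, l, structureLabel, wordAct_one, Sum.elim_inr]
    exact @decide_eq_true_iff _ (_)
  have hsh : ∀ (m : ShiftMonoid.{u}) (x x' : E.carrier),
      shift m (toShift hrel l x).1 = (toShift hrel l x').1 ↔ wordAct g m x = x' := by
    intro m x x'
    simp only [toShift, shift_orbitLabelling]
    exact (orbitLabelling_injective hl).eq_iff
  constructor
  · intro h
    -- Positive arity provides the base point.
    have hk : k ≠ 0 := by
      rintro rfl
      exact T.arity_pos.false R
    let j : Fin k := ⟨0, Nat.pos_of_ne_zero hk⟩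
    choose m hm using fun i => (rel_iff_exists_wordAct hrel (y j) (y i)).1 (hy j i)
    refine ⟨j, m, fun i => (hsh _ _ _).2 (hm i), (hlab j m).2 ?_⟩
    simpa only [hm] using h
  · rintro ⟨j, m, hm, h⟩
    have h' := (hlab j m).1 h
    have hm' : ∀ i, wordAct g (m i) (y j) = y i := fun i => (hsh _ _ _).1 (hm i)
    simpa only [hm'] using h'

end Universal

section Coding

open Set MeasureTheory

/-! ### The theory of the maps into a fixed equivalence relation -/

/-- A property of tuples in structures that is expressed by a formula. -/
def IsExpressible (L : FirstOrder.Language.{0, 0}) (n : ℕ)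
    (P : ∀ (M : Type u), L.Structure M → (Fin n → M) → Prop) : Prop :=
  ∃ φ : InfFormula L n, ∀ M S x, φ.Realize S x ↔ P M S x

namespace IsExpressible

variable {L : FirstOrder.Language.{0, 0}} {n : ℕ}
  {P Q : ∀ (M : Type u), L.Structure M → (Fin n → M) → Prop}

theorem equal (i j : Fin n) : IsExpressible.{u} L n fun _ _ x => x i = x j :=
  ⟨.equal i j, fun _ _ _ => Iff.rfl⟩

theorem imp (hP : IsExpressible L n P) (hQ : IsExpressible L n Q) :
    IsExpressible L n fun M S x => P M S x → Q M S x :=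
  let ⟨φ, hφ⟩ := hP
  let ⟨ψ, hψ⟩ := hQ
  ⟨.imp φ ψ, fun M S x => imp_congr (hφ M S x) (hψ M S x)⟩

theorem not (hP : IsExpressible L n P) : IsExpressible L n fun M S x => ¬ P M S x :=
  hP.imp ⟨.falsum, fun _ _ _ => Iff.rfl⟩

theorem forall_nat {P : ℕ → ∀ (M : Type u), L.Structure M → (Fin n → M) → Prop}
    (hP : ∀ i, IsExpressible L n (P i)) : IsExpressible L n fun M S x => ∀ i, P i M S x := by
  choose φ hφ using hP
  exact ⟨.conj φ, fun M S x => forall_congr' fun i => hφ i M S x⟩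

theorem exists_nat {P : ℕ → ∀ (M : Type u), L.Structure M → (Fin n → M) → Prop}
    (hP : ∀ i, IsExpressible L n (P i)) : IsExpressible L n fun M S x => ∃ i, P i M S x := by
  simpa only [not_forall, not_not] using (forall_nat fun i => (hP i).not).not

theorem and (hP : IsExpressible L n P) (hQ : IsExpressible L n Q) :
    IsExpressible L n fun M S x => P M S x ∧ Q M S x := by
  simpa only [Classical.not_imp, not_not] using (hP.imp hQ.not).not

theorem all {P : ∀ (M : Type u), L.Structure M → (Fin (n + 1) → M) → Prop}
    (hP : IsExpressible L (n + 1) P) :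
    IsExpressible L n fun M S x => ∀ a, P M S (Fin.snoc x a) :=
  let ⟨φ, hφ⟩ := hP
  ⟨.all φ, fun M S _ => forall_congr' fun _ => hφ M S _⟩

theorem ex {P : ∀ (M : Type u), L.Structure M → (Fin (n + 1) → M) → Prop}
    (hP : IsExpressible L (n + 1) P) :
    IsExpressible L n fun M S x => ∃ a, P M S (Fin.snoc x a) := by
  simpa only [not_forall, not_not] using hP.not.all.not

end IsExpressible

/-- The relation symbols of the language with countably many unary predicates. -/
inductive UnaryRelation : ℕ → Type
  | pred (i : ℕ) : UnaryRelation 1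

/-- The language with countably many unary predicates. -/
def unaryLanguage : FirstOrder.Language.{0, 0} := ⟨fun _ => Empty, UnaryRelation⟩

theorem isRelational_unaryLanguage : unaryLanguage.IsRelational :=
  fun _ => inferInstanceAs (IsEmpty Empty)

/-- The real coded by the predicates at a point. -/
noncomputable def code {M : Type u} (S : unaryLanguage.Structure M) (y : M) : ℕ → Bool := by
  classical
  exact fun i => decide (S.RelMap (UnaryRelation.pred i) fun _ => y)

theorem code_eq_true {M : Type u} (S : unaryLanguage.Structure M) (y : M) (i : ℕ) :
    code S y i = true ↔ S.RelMap (UnaryRelation.pred i) fun _ => y := by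
  simp [code]

theorem measurable_code (E : CBER.{u}) {S : unaryLanguage.Structure E.carrier}
    (hS : E.IsBorelStructureOn S) : Measurable (code S) := by
  refine measurable_pi_lambda _ fun i => measurable_to_bool ?_
  convert (measurable_pi_lambda (fun (y : E.carrier) (_ : Fin 1) => y) fun _ => measurable_id)
    (hS 1 (UnaryRelation.pred i)).1 using 1
  ext y
  exact code_eq_true S y i

/-- Borel properties of the coded reals are expressible. -/
theorem isExpressible_of_measurableSet {n : ℕ} {B : Set (Fin n → ℕ → Bool)}
    (hB : MeasurableSet B) :
    IsExpressible.{u} unaryLanguage n fun _ S x => (fun i => code S (x i)) ∈ B := by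
  -- The sets with expressible membership form a `σ`-algebra; it contains the subbasic cylinders,
  -- hence all Borel sets.
  let D : MeasurableSpace (Fin n → ℕ → Bool) :=
    { MeasurableSet' := fun B =>
        IsExpressible.{u} unaryLanguage n fun _ S x => (fun i => code S (x i)) ∈ B
      measurableSet_empty := ⟨.falsum, fun _ _ _ => Iff.rfl⟩
      measurableSet_compl := fun _ h => h.not
      measurableSet_iUnion := fun A h => by
        simpa only [mem_iUnion] using IsExpressible.exists_nat h }
  have h : @Measurable _ _ D MeasurableSpace.pi (id : (Fin n → ℕ → Bool) → _) := by
    refine @measurable_pi_lambda _ _ _ D _ _ fun j => ?_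
    refine @measurable_pi_lambda _ _ _ D _ _ fun i => ?_
    refine @measurable_to_bool _ D _ ?_
    exact ⟨.rel (UnaryRelation.pred i) fun _ => j, fun M S x => (code_eq_true S (x j) i).symm⟩
  exact h hB

theorem isExpressible_of_measurableSet_prod {B : Set ((ℕ → Bool) × (ℕ → Bool))}
    (hB : MeasurableSet B) :
    IsExpressible.{u} unaryLanguage 2 fun _ S x => (code S (x 0), code S (x 1)) ∈ B :=
  isExpressible_of_measurableSet
    (((measurable_pi_apply (0 : Fin 2)).prodMk (measurable_pi_apply (1 : Fin 2))) hB)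

/-- The theory in the language of countably many unary predicates with a given sentence. -/
def unaryTheory (φ : InfFormula unaryLanguage 0) : InfTheory where
  lang := unaryLanguage
  relational := isRelational_unaryLanguage
  countable_rel := by
    refine Function.Surjective.countable
      (f := fun i : ℕ => (⟨1, UnaryRelation.pred i⟩ : Σ n, UnaryRelation n)) ?_
    rintro ⟨_, ⟨i⟩⟩
    exact ⟨i, rfl⟩
  arity_pos := ⟨fun R => nomatch (R : UnaryRelation 0)⟩
  sentence := φ

/-- There is a sentence saying that the coded reals form a copy of a class, given by a Borel
equivalence relation `C` that is the union of the graphs `B n`, with domains `A n`. -/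
theorem exists_sentence {C : Set ((ℕ → Bool) × (ℕ → Bool))} (hC : MeasurableSet C)
    {A : ℕ → Set (ℕ → Bool)} (hA : ∀ n, MeasurableSet (A n))
    {B : ℕ → Set ((ℕ → Bool) × (ℕ → Bool))} (hB : ∀ n, MeasurableSet (B n)) :
    ∃ φ : InfFormula unaryLanguage 0, ∀ (M : Type u) (S : unaryLanguage.Structure M),
      φ.Realize S Fin.elim0 ↔ (∀ y y', (code S y, code S y') ∈ C) ∧
        (∀ y y', code S y = code S y' → y = y') ∧
        ∀ n y, code S y ∈ A n → ∃ y', (code S y, code S y') ∈ B n := by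
  have h1 := (isExpressible_of_measurableSet_prod.{u} hC).all.all
  have hdiag : MeasurableSet {p : (ℕ → Bool) × (ℕ → Bool) | p.1 = p.2} :=
    measurableSet_eq_fun measurable_fst measurable_snd
  have h2 := ((isExpressible_of_measurableSet_prod.{u} hdiag).imp
    (IsExpressible.equal 0 1)).all.all
  have h3 := IsExpressible.forall_nat fun n =>
    ((isExpressible_of_measurableSet.{u} (measurable_pi_apply (0 : Fin 1) (hA n))).imp
      (isExpressible_of_measurableSet_prod.{u} (hB n)).ex).all
  obtain ⟨φ, hφ⟩ := h1.and (h2.and h3)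
  exact ⟨φ, fun M S => hφ M S Fin.elim0⟩

open CBER in
-- With `E` coded in the reals by `c`, the three clauses of `exists_sentence` say that the decoded
-- map is a homomorphism, is injective on classes, and is onto classes. The last holds when each
-- graph `B n` defined at an image point has its value attained.
theorem isElementary_elementaryClass (E : CBER.{u}) : IsElementary E.elementaryClass := by
  obtain ⟨B, hB, hrel⟩ := E.exists_graphs
  let c : E.carrier → ℕ → Bool := MeasurableSpace.mapNatBool E.carrier
  have hcm : Measurable c := MeasurableSpace.measurable_mapNatBool E.carrier
  have hc : Function.Injective c := MeasurableSpace.injective_mapNatBool E.carrier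
  have hcc : MeasurableEmbedding (Prod.map c c) :=
    (hcm.prodMap hcm).measurableEmbedding (hc.prodMap hc)
  have hmem : ∀ (D : Set (E.carrier × E.carrier)) a b,
      (c a, c b) ∈ Prod.map c c '' D ↔ (a, b) ∈ D := fun D a b =>
    (hc.prodMap hc).mem_set_image (a := (a, b))
  obtain ⟨φ, hφ⟩ := exists_sentence.{u}
    (C := Prod.map c c '' {p | E.rel p.1 p.2}) (hcc.measurableSet_image.2 E.measurableSet_rel)
    (A := fun n => (c ∘ Prod.fst) '' B n)
    (fun n => (hB n).1.image_of_measurable_injOn (hcm.comp measurable_fst)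
      (hc.comp_injOn (hB n).2))
    (B := fun n => Prod.map c c '' B n) (fun n => hcc.measurableSet_image.2 (hB n).1)
  refine ⟨unaryTheory φ, Set.ext fun F => ⟨?_, ?_⟩⟩
  · rintro ⟨f, hf⟩
    let S : unaryLanguage.Structure F.carrier :=
      { funMap := fun {n} g _ => ((isRelational_unaryLanguage n).false g).elim
        RelMap := fun {k} R => match k, R with
          | _, .pred i => fun x => c (f (x 0)) i = true }
    have hcode : ∀ y, code S y = c (f y) := fun y => funext fun i => by
      rw [Bool.eq_iff_iff, code_eq_true]
      exact Iff.rfl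
    refine ⟨S, ?_, fun z => (hφ _ _).2 ?_⟩
    · rintro _ ⟨i⟩
      constructor
      · exact ((measurable_pi_apply i).comp (hcm.comp (hf.1.1.comp (measurable_pi_apply 0))))
          (measurableSet_singleton true)
      · intro x _ a b
        rw [Subsingleton.elim a b]
        exact F.equivalence.refl _
    · have hcode' : ∀ y : F.cls z,
          code (restrict isRelational_unaryLanguage S (F.cls z)) y = c (f y) := fun y => hcode y
      change (∀ y y' : F.cls z, _) ∧ (∀ y y' : F.cls z, _) ∧ ∀ n, ∀ y : F.cls z, _
      refine ⟨fun y y' => ?_, fun y y' h => ?_, fun n y hy => ?_⟩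
      · erw [hcode', hcode', hmem]
        exact hf.1.2 _ _ (F.rel_of_mem_cls y.2 y'.2)
      · erw [hcode', hcode'] at h
        exact Subtype.ext ((hf.2 z).2.1 y.2 y'.2 (hc h))
      · erw [hcode'] at hy
        obtain ⟨⟨a, b⟩, hab, ha⟩ := hy
        obtain rfl : a = f y := hc ha
        obtain ⟨y', hy', rfl⟩ := (hf.2 y).2.2 ((hrel _ _).2 ⟨n, hab⟩)
        refine ⟨⟨y', F.equivalence.trans y.2 hy'⟩, ?_⟩
        erw [hcode', hcode', hmem]
        exact hab
  · rintro ⟨S, hS, hmod⟩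
    change unaryLanguage.Structure F.carrier at S
    have hmod' := fun z => (hφ _ _).1 (hmod z)
    have hcode : ∀ z (y : F.cls z),
        code (restrict isRelational_unaryLanguage S (F.cls z)) y = code S y := fun _ _ => rfl
    -- The first clause, applied to the pair `(y, y)`, puts the coded real in the range of `c`.
    have hex : ∀ y, ∃ x, c x = code S y := by
      intro y
      obtain ⟨⟨a, b⟩, -, h⟩ := (hmod' y).1 ⟨y, F.mem_cls_self y⟩ ⟨y, F.mem_cls_self y⟩
      exact ⟨a, congrArg Prod.fst h⟩
    choose f hf using hex
    have hfm : Measurable f := by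
      have := measurable_code F hS
      rw [← funext hf] at this
      exact (hcm.measurableEmbedding hc).measurable_comp_iff.1 this
    have hom : ∀ x y, F.rel x y → E.rel (f x) (f y) := by
      intro x y h
      have := (hmod' x).1 ⟨x, F.mem_cls_self x⟩ ⟨y, h⟩
      erw [hcode, hcode, ← hf, ← hf, hmem] at this
      exact this
    refine ⟨f, ⟨hfm, hom⟩, fun z => ⟨fun y hy => hom z y hy, fun y hy y' hy' h => ?_, ?_⟩⟩
    · have := (hmod' z).2.1 ⟨y, hy⟩ ⟨y', hy'⟩ (by erw [hcode, hcode, ← hf, ← hf, h])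
      exact congrArg Subtype.val this
    · intro x hx
      obtain ⟨n, hn⟩ := (hrel _ _).1 hx
      obtain ⟨⟨y, hy⟩, h⟩ := (hmod' z).2.2 n ⟨z, F.mem_cls_self z⟩ ⟨_, hn, hf z⟩
      erw [hcode, hcode, ← hf, ← hf, hmem] at h
      -- `B n` is the graph of a partial function, so the value attained at `f z` is `x` itself.
      exact ⟨y, hy, congrArg Prod.snd ((hB n).2 h hn rfl)⟩

/-- Universality gives one inclusion, as invariant embeddings are class-bijective; downward closure
below `E ∈ 𝓒` gives the other. -/
theorem eq_elementaryClass {𝓒 : Set CBER.{u}} (h : IsClosedUnderClassBijective 𝓒) {E : CBER.{u}}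
    (hE : IsInvariantlyUniversalIn E 𝓒) : 𝓒 = E.elementaryClass :=
  Set.ext fun F => ⟨fun hF => (hE.2 F hF).classBijects, fun hF => h F E hF hE.1⟩

theorem IsElementary.isClosedUnderClassBijective {𝓒 : Set CBER.{u}} (h : IsElementary 𝓒) :
    IsClosedUnderClassBijective 𝓒 := by
  obtain ⟨T, rfl⟩ := h
  exact fun _ _ hEF hF => hEF.structurable hF

end Coding

end Structurability

theorem corollary4p9 (𝓒 : Set Structurability.CBER.{u}) :
    (Structurability.IsElementary 𝓒 ↔
      Structurability.IsClosedUnderClassBijective 𝓒 ∧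
        ∃ E, Structurability.IsInvariantlyUniversalIn E 𝓒) ∧
    (Structurability.IsElementary 𝓒 →
      ∀ E, Structurability.IsInvariantlyUniversalIn E 𝓒 → 𝓒 = E.elementaryClass) := by
  refine ⟨⟨fun h => ⟨h.isClosedUnderClassBijective, ?_⟩, ?_⟩,
    fun h E hE => Structurability.eq_elementaryClass h.isClosedUnderClassBijective hE⟩
  · obtain ⟨T, rfl⟩ := h
    exact Structurability.exists_isInvariantlyUniversalIn_structurable T
  · rintro ⟨h, E, hE⟩
    rw [Structurability.eq_elementaryClass h hE]
    exact Structurability.isElementary_elementaryClass E
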